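/- Let $\mathcal H$ be a complex Hilbert space. A \emph{reflection} on $\mathcal H$ is a Hermitian operator $R$ with $R^2 = I$, and a \emph{qubit} in $\mathcal H$ is a pair $(X, Z)$ of reflections on $\mathcal H$ that anti-commute, $XZ + ZX = 0$. The \emph{overlap} of two qubits $(X_1, Z_1)$ and $(X_2, Z_2)$ is $\max_{S, T \in \{X, Z\}} \|[S_1, T_2]\|$, where $[S, T] = ST - TS$ and $\|\cdot\|$ is the operator norm. Let $n \ge 1$ be an integer, suppose $\dim \mathcal H = 2^n$, and let $\epsilon < 1$ be a real number with $\epsilon/(1-\epsilon)^2 \le 1/(64 n)$. If $(X_1, Z_1), \ldots, (X_m, Z_m)$ are qubits in $\mathcal H$ whose pairwise overlaps are at most $\epsilon$, that is, $\|[S_i, T_j]\| \le \epsilon$ for all $i \ne j$ and all $S, T \in \{X, Z\}$, then $m \le n$. -/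

import Mathlib

/-- A reflection on a complex Hilbert space: a Hermitian (bounded) operator that squares to the
identity. -/
def IsHermitianReflection {H : Type*} [NormedAddCommGroup H] [InnerProductSpace ℂ H]
    [CompleteSpace H] (R : H →L[ℂ] H) : Prop :=
  IsSelfAdjoint R ∧ R * R = 1

/-- A qubit in a Hilbert space `H`: a pair `(X, Z)` of anti-commuting reflections on `H`. -/
structure Qubit (H : Type*) [NormedAddCommGroup H] [InnerProductSpace ℂ H]
    [CompleteSpace H] where
  /-- The first reflection. -/
  X : H →L[ℂ] H
  /-- The second reflection. -/
  Z : H →L[ℂ] H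
  isReflection_X : IsHermitianReflection X
  isReflection_Z : IsHermitianReflection Z
  anticommute : X * Z + Z * X = 0

/-- The overlap `max_{S, T ∈ {X, Z}} ‖[S₁, T₂]‖` of two qubits, where `[S, T] = S T - T S` and
the norm is the operator norm. -/
noncomputable def Qubit.overlap {H : Type*} [NormedAddCommGroup H] [InnerProductSpace ℂ H]
    [CompleteSpace H] (q₁ q₂ : Qubit H) : ℝ :=
  max (max ‖q₁.X * q₂.X - q₂.X * q₁.X‖ ‖q₁.X * q₂.Z - q₂.Z * q₁.X‖)
    (max ‖q₁.Z * q₂.X - q₂.X * q₁.Z‖ ‖q₁.Z * q₂.Z - q₂.Z * q₁.Z‖)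

/-! ### Repairing approximate relations in a C⋆-algebra. -/

section CStar

variable {A : Type*} [CStarAlgebra A]

/-! Induction on `n`, splitting off one qubit `p` at a time. Since `p.X` swaps the eigenspaces of
`p.Z`, the `+1` eigenspace has half the dimension. The twirl `E` over `p` moves every other
reflection by at most `ε`. Because `E` is a conditional expectation, `E (a * b) - E a * E b = E ((a
- E a) * (b - E b))`, so twirled reflections satisfy the qubit relations up to order `ε ^ 2`, not
merely `ε`. They preserve the `+1` eigenspace, where functional calculus turns them into exact
qubits at a further cost of order `ε ^ 2`.

Overlaps thus grow from `ε` to `ε + 30 * ε ^ 2` per step, so `1 / ε` drops by at most a constant,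
and a bound `64 * n * ε ≤ 1` survives the passage from `n + 1` to `n`. In dimension 1 no qubit
exists. -/

/-- A self-adjoint element whose square is close to `1` is close to a self-adjoint involution,
which anticommutes with everything that anticommutes with the given element. -/
theorem exists_involution_near {a : A} (ha : IsSelfAdjoint a) {δ : ℝ} (hδ : δ < 1)
    (h : ‖a * a - 1‖ ≤ δ) :
    ∃ s : A, IsSelfAdjoint s ∧ s * s = 1 ∧ ‖s - a‖ ≤ δ ∧ ∀ x, x * a = -(a * x) → x * s = -(s * x) := by
  have hsq : cfc (fun x : ℝ => x * x - 1) a = a * a - 1 := by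
    rw [cfc_sub (fun x : ℝ => x * x) (fun _ => 1) a, cfc_mul (fun x : ℝ => x) (fun x => x) a,
      cfc_id' ℝ a, cfc_const_one ℝ a]
  have hspec : ∀ x ∈ spectrum ℝ a, |x * x - 1| ≤ δ := fun x hx => by
    have := norm_apply_le_norm_cfc (fun x : ℝ => x * x - 1) a hx
    rw [hsq, Real.norm_eq_abs] at this
    exact this.trans h
  have hne : ∀ x ∈ spectrum ℝ a, x ≠ 0 := by
    rintro x hx rfl
    have := hspec 0 hx
    norm_num at this
    linarith
  have hcont : ContinuousOn (fun x : ℝ => |x|⁻¹) (spectrum ℝ a) :=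
    ContinuousOn.inv₀ (by fun_prop) fun x hx => abs_ne_zero.2 (hne x hx)
  have hcont₁ : ContinuousOn (fun x : ℝ => x * |x|⁻¹) (spectrum ℝ a) := continuousOn_id.mul hcont
  have hcont' : ContinuousOn (fun x : ℝ => (√x)⁻¹) ((fun x => x ^ 2) '' spectrum ℝ a) := by
    refine ContinuousOn.inv₀ (by fun_prop) ?_
    rintro _ ⟨x, hx, rfl⟩
    simpa [Real.sqrt_sq_eq_abs] using hne x hx
  have hs : cfc (fun x : ℝ => x * |x|⁻¹) a = a * cfc (fun x : ℝ => |x|⁻¹) a := by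
    rw [cfc_mul (fun x : ℝ => x) (fun x => |x|⁻¹) a (by fun_prop) hcont, cfc_id' ℝ a]
  -- The involution is the sign `a * |a|⁻¹`. Writing `|a|⁻¹` as a function of `a ^ 2` makes it
  -- commute with whatever anticommutes with `a`.
  have hg : cfc (fun x : ℝ => |x|⁻¹) a = cfc (fun x : ℝ => (√x)⁻¹) (a ^ 2) := by
    rw [← cfc_comp_pow (fun x : ℝ => (√x)⁻¹) 2 a hcont']
    simp only [Real.sqrt_sq_eq_abs]
  refine ⟨cfc (fun x : ℝ => x * |x|⁻¹) a, cfc_predicate _ _, ?_, ?_, fun x hx => ?_⟩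
  · rw [← cfc_mul _ _ a hcont₁ hcont₁, ← cfc_one ℝ a]
    refine cfc_congr fun x hx => ?_
    have h0 := abs_ne_zero.2 (hne x hx)
    have h1 := abs_mul_abs_self x
    simp only [Pi.one_apply]
    field_simp
    nlinarith
  · have : cfc (fun x : ℝ => x * |x|⁻¹ - x) a = cfc (fun x : ℝ => x * |x|⁻¹) a - a := by
      rw [cfc_sub (fun x : ℝ => x * |x|⁻¹) (fun x => x) a hcont₁, cfc_id' ℝ a]
    rw [← this]
    -- On the spectrum, `|sign x - x| = |1 - |x|| ≤ |x ^ 2 - 1|`, as `|x| + 1 ≥ 1`.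
    refine norm_cfc_le ((norm_nonneg _).trans h) fun x hx => ?_
    have h0 := abs_pos.2 (hne x hx)
    have h1 : x * |x|⁻¹ - x = (x * |x|⁻¹) * (1 - |x|) := by field_simp
    have h2 := hspec x hx
    rw [← abs_mul_abs_self x, show |x| * |x| - 1 = (|x| - 1) * (|x| + 1) by ring, abs_mul,
      abs_of_pos (a := |x| + 1) (by linarith)] at h2
    rw [h1, Real.norm_eq_abs, abs_mul, abs_mul, abs_inv, abs_abs, mul_inv_cancel₀ h0.ne', one_mul,
      abs_sub_comm]
    nlinarith [abs_nonneg (|x| - 1)]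
  · rw [hs, hg]
    have hc : Commute (a ^ 2) x := by
      rw [Commute, SemiconjBy, pow_two, mul_assoc, ← mul_assoc x, hx, neg_mul, mul_assoc, hx]
      simp
    have := (hc.cfc_real (fun x : ℝ => (√x)⁻¹)).eq
    rw [← mul_assoc, hx, mul_assoc, this, neg_mul, mul_assoc]

theorem norm_le_one_of_involution {s : A} (hs : IsSelfAdjoint s) (h : s * s = 1) : ‖s‖ ≤ 1 := by
  have h1 := CStarRing.norm_star_mul_self (x := s)
  rw [hs.star_eq, h] at h1
  have h2 : ‖(1 : A)‖ ≤ 1 := by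
    rcases subsingleton_or_nontrivial A with _ | _
    · simp [Subsingleton.elim (1 : A) 0]
    · simp
  nlinarith [norm_nonneg s]

theorem norm_mul_le_of_le_one_left {a b : A} {c : ℝ} (ha : ‖a‖ ≤ 1) (hb : ‖b‖ ≤ c) :
    ‖a * b‖ ≤ c :=
  (norm_mul_le _ _).trans (by nlinarith [norm_nonneg a, norm_nonneg b])

theorem norm_mul_le_of_le_one_right {a b : A} {c : ℝ} (ha : ‖a‖ ≤ c) (hb : ‖b‖ ≤ 1) :
    ‖a * b‖ ≤ c :=
  (norm_mul_le _ _).trans (by nlinarith [norm_nonneg a, norm_nonneg b])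

/-- Two self-adjoint elements that nearly square to `1` and nearly anticommute are close to two
anticommuting involutions. -/
theorem exists_anticommuting_involutions_near {a b : A} (ha : IsSelfAdjoint a)
    (hb : IsSelfAdjoint b) (hb1 : ‖b‖ ≤ 1) {δ : ℝ} (hδ : 5 * δ < 1)
    (haa : ‖a * a - 1‖ ≤ δ) (hbb : ‖b * b - 1‖ ≤ δ) (hab : ‖a * b + b * a‖ ≤ 2 * δ) :
    ∃ x z : A, IsSelfAdjoint x ∧ x * x = 1 ∧ IsSelfAdjoint z ∧ z * z = 1 ∧ x * z + z * x = 0 ∧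
      ‖x - a‖ ≤ 7 * δ ∧ ‖z - b‖ ≤ 7 * δ := by
  have hδ0 : 0 ≤ δ := (norm_nonneg _).trans haa
  obtain ⟨x, hx, hxx, hxa, -⟩ := exists_involution_near ha (by linarith) haa
  have hx1 := norm_le_one_of_involution hx hxx
  have hhalf : ‖(1 / 2 : ℝ)‖ = 1 / 2 := by norm_num
  -- The part of `b` that anticommutes exactly with `x`; its sign `z` then does too. Errors: `2δ`
  -- from `b` to `c`, and `5δ` from `c` to `z`.
  set c : A := (1 / 2 : ℝ) • (b - x * b * x) with hc
  have hcs : IsSelfAdjoint c := (IsSelfAdjoint.all _).smul (hb.sub (hb.conjugate_self hx))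
  have hxbx : ‖x * b * x‖ ≤ 1 :=
    norm_mul_le_of_le_one_right (norm_mul_le_of_le_one_left hx1 hb1) hx1
  have hc1 : ‖c‖ ≤ 1 := by
    rw [hc, norm_smul, hhalf]
    linarith [norm_sub_le b (x * b * x)]
  have hxb : ‖x * b + b * x‖ ≤ 4 * δ := by
    have e : x * b + b * x = (a * b + b * a) + ((x - a) * b + b * (x - a)) := by noncomm_ring
    have h1 := norm_mul_le_of_le_one_right hxa hb1
    have h2 := norm_mul_le_of_le_one_left hb1 hxa
    rw [e]
    linarith [norm_add_le (a * b + b * a) ((x - a) * b + b * (x - a)),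
      norm_add_le ((x - a) * b) (b * (x - a))]
  have hcb : ‖c - b‖ ≤ 2 * δ := by
    have e : c - b = -((1 / 2 : ℝ) • (x * (x * b + b * x))) := by
      rw [hc, mul_add, ← mul_assoc, hxx, one_mul, ← mul_assoc]
      module
    rw [e, norm_neg, norm_smul, hhalf]
    linarith [norm_mul_le_of_le_one_left hx1 hxb]
  have hcc : ‖c * c - 1‖ ≤ 5 * δ := by
    have e : c * c - 1 = (b * b - 1) + (c * (c - b) + (c - b) * b) := by noncomm_ring
    rw [e]
    linarith [norm_add_le (b * b - 1) (c * (c - b) + (c - b) * b),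
      norm_add_le (c * (c - b)) ((c - b) * b), norm_mul_le_of_le_one_right hcb hb1,
      norm_mul_le_of_le_one_left hc1 hcb]
  have hxc : x * c = -(c * x) := by
    have e : x * (x * b * x) = b * x := by rw [← mul_assoc, ← mul_assoc, hxx, one_mul]
    have e' : x * b * x * x = x * b := by rw [mul_assoc, hxx, mul_one]
    rw [hc, mul_smul_comm, smul_mul_assoc, mul_sub, sub_mul, e, e']
    module
  obtain ⟨z, hz, hzz, hzc, hxz⟩ := exists_involution_near hcs hδ hcc
  refine ⟨x, z, hx, hxx, hz, hzz, by rw [hxz x hxc, neg_add_cancel], by linarith, ?_⟩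
  linarith [norm_sub_le_norm_sub_add_norm_sub z c b]

/-! ### Pinching and twirling. -/

/-- The average of `a` and its conjugate by `r`. -/
noncomputable def pinch (r a : A) : A := (1 / 2 : ℝ) • (a + r * a * r)

theorem pinch_add (r a b : A) : pinch r (a + b) = pinch r a + pinch r b := by
  simp only [pinch, mul_add, add_mul]; module

theorem pinch_sub (r a b : A) : pinch r (a - b) = pinch r a - pinch r b := by
  simp only [pinch, mul_sub, sub_mul]; module

theorem pinch_isSelfAdjoint {r a : A} (hr : IsSelfAdjoint r) (ha : IsSelfAdjoint a) :
    IsSelfAdjoint (pinch r a) :=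
  (IsSelfAdjoint.all _).smul (ha.add (ha.conjugate_self hr))

theorem norm_pinch_le {r : A} (hr : ‖r‖ ≤ 1) (a : A) : ‖pinch r a‖ ≤ ‖a‖ := by
  have hhalf : ‖(1 / 2 : ℝ)‖ = 1 / 2 := by norm_num
  rw [pinch, norm_smul, hhalf]
  linarith [norm_add_le a (r * a * r),
    norm_mul_le_of_le_one_right (norm_mul_le_of_le_one_left hr (le_refl ‖a‖)) hr]

theorem pinch_commute {r : A} (hr : r * r = 1) (a : A) : Commute r (pinch r a) := by
  have e : r * (r * a * r) = a * r := by rw [← mul_assoc, ← mul_assoc, hr, one_mul]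
  have e' : r * a * r * r = r * a := by rw [mul_assoc, hr, mul_one]
  rw [Commute, SemiconjBy, pinch, mul_smul_comm, smul_mul_assoc, mul_add, add_mul, e, e', add_comm]

/-- Moving `s` past the two factors `r` gives two signs that cancel. Hence the outer pinch of a
twirl keeps what the inner one achieved. -/
theorem Commute.pinch_of_anticommute {r s a : A} (hsr : s * r = -(r * s)) (h : Commute s a) :
    Commute s (pinch r a) := by
  have e : s * (r * a * r) = r * a * r * s := by
    rw [mul_assoc (r * a), ← neg_eq_iff_eq_neg.2 hsr]
    simp only [← mul_assoc]
    rw [hsr]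
    simp only [mul_neg, neg_mul, mul_assoc]
    rw [← mul_assoc s, h.eq, mul_assoc, hsr]
    simp only [mul_neg]
  rw [Commute, SemiconjBy, pinch, mul_smul_comm, smul_mul_assoc, mul_add, add_mul, e, h.eq]

theorem pinch_mul_right {r b : A} (h : Commute r b) (a : A) :
    pinch r (a * b) = pinch r a * b := by
  have e : r * (a * b) * r = r * a * r * b := by
    simp only [mul_assoc]; rw [h.eq]
  rw [pinch, pinch, smul_mul_assoc, add_mul, e]

theorem pinch_mul_left {r b : A} (h : Commute r b) (a : A) :
    pinch r (b * a) = b * pinch r a := by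
  have e : r * (b * a) * r = b * (r * a * r) := by
    simp only [← mul_assoc]; rw [h.eq]
  rw [pinch, pinch, mul_smul_comm, mul_add, e]

theorem pinch_one {r : A} (hr : r * r = 1) : pinch r 1 = 1 := by
  rw [pinch, mul_one, hr]; module

/-- The difference is half a commutator times `r`; the factor 1/2 lets the two pinches of a twirl
cost only `ε` together. -/
theorem norm_sub_pinch_le {r : A} (hr : r * r = 1) (hr1 : ‖r‖ ≤ 1) {a : A} {ε : ℝ}
    (h : ‖r * a - a * r‖ ≤ ε) : ‖a - pinch r a‖ ≤ ε / 2 := by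
  have hhalf : ‖(1 / 2 : ℝ)‖ = 1 / 2 := by norm_num
  have e : a - pinch r a = -((1 / 2 : ℝ) • ((r * a - a * r) * r)) := by
    rw [sub_mul, mul_assoc a, hr, mul_one, pinch]; module
  rw [e, norm_neg, norm_smul, hhalf]
  linarith [norm_mul_le_of_le_one_right h hr1]

/-- Two anticommuting self-adjoint involutions. -/
structure IsPauliPair (x z : A) : Prop where
  isSelfAdjoint_left : IsSelfAdjoint x
  left_mul_self : x * x = 1
  isSelfAdjoint_right : IsSelfAdjoint z
  right_mul_self : z * z = 1
  anticommute : x * z + z * x = 0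

/-- The conditional expectation onto the commutant of `x` and `z`. -/
noncomputable def twirl (x z a : A) : A := pinch x (pinch z a)

namespace IsPauliPair

variable {x z : A}

theorem norm_left (h : IsPauliPair x z) : ‖x‖ ≤ 1 := norm_le_one_of_involution h.1 h.2

theorem norm_right (h : IsPauliPair x z) : ‖z‖ ≤ 1 := norm_le_one_of_involution h.3 h.4

theorem norm_twirl_le (h : IsPauliPair x z) (a : A) : ‖twirl x z a‖ ≤ ‖a‖ :=
  (norm_pinch_le h.norm_left _).trans (norm_pinch_le h.norm_right _)

theorem twirl_isSelfAdjoint (h : IsPauliPair x z) {a : A} (ha : IsSelfAdjoint a) : IsSelfAdjoint (twirl x z a) :=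
  pinch_isSelfAdjoint h.1 (pinch_isSelfAdjoint h.3 ha)

theorem commute_left_twirl (h : IsPauliPair x z) (a : A) : Commute x (twirl x z a) := pinch_commute h.2 _

theorem commute_right_twirl (h : IsPauliPair x z) (a : A) : Commute z (twirl x z a) :=
  Commute.pinch_of_anticommute (eq_neg_of_add_eq_zero_right h.5) (pinch_commute h.4 a)

theorem twirl_one (h : IsPauliPair x z) : twirl x z 1 = 1 := by rw [twirl, pinch_one h.4, pinch_one h.2]

theorem norm_sub_twirl_le (h : IsPauliPair x z) {a : A} {ε : ℝ} (hx : ‖x * a - a * x‖ ≤ ε) (hz : ‖z * a - a * z‖ ≤ ε) :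
    ‖a - twirl x z a‖ ≤ ε := by
  have h1 := norm_sub_pinch_le h.2 h.norm_left hx
  have h2 := norm_sub_pinch_le h.4 h.norm_right hz
  have h3 := norm_pinch_le h.norm_left (a - pinch z a)
  rw [pinch_sub] at h3
  have h4 : ‖pinch x a - twirl x z a‖ ≤ _ := h3
  linarith [norm_sub_le_norm_sub_add_norm_sub a (pinch x a) (twirl x z a)]

theorem twirl_mul_right (h : IsPauliPair x z) (a b : A) : twirl x z (a * twirl x z b) = twirl x z a * twirl x z b := by
  rw [twirl, pinch_mul_right (h.commute_right_twirl b), pinch_mul_right (h.commute_left_twirl b),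
    ← twirl]

theorem twirl_mul_left (h : IsPauliPair x z) (a b : A) : twirl x z (twirl x z a * b) = twirl x z a * twirl x z b := by
  rw [twirl, pinch_mul_left (h.commute_right_twirl a), pinch_mul_left (h.commute_left_twirl a),
    ← twirl]

theorem twirl_add (a b : A) : twirl x z (a + b) = twirl x z a + twirl x z b := by
  simp only [twirl, pinch_add]

theorem twirl_sub (a b : A) : twirl x z (a - b) = twirl x z a - twirl x z b := by
  simp only [twirl, pinch_sub]

/-- The source of the second-order gain: by the bimodule property the defect is, up to sign, the
twirl of a product of two factors of norm at most `ε`. -/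
theorem norm_twirl_mul_sub_le (h : IsPauliPair x z) {a b : A} {ε : ℝ} (ha : ‖a - twirl x z a‖ ≤ ε)
    (hb : ‖b - twirl x z b‖ ≤ ε) :
    ‖twirl x z a * twirl x z b - twirl x z (a * b)‖ ≤ ε ^ 2 := by
  have e1 := h.twirl_mul_right a b
  have e2 := h.twirl_mul_left a b
  have e3 : twirl x z (twirl x z b) = twirl x z b := by
    have := h.twirl_mul_right 1 b
    rwa [one_mul, h.twirl_one, one_mul] at this
  have e4 := h.twirl_mul_left a (twirl x z b)
  have e : twirl x z ((a - twirl x z a) * (b - twirl x z b)) =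
      twirl x z (a * b) - twirl x z a * twirl x z b := by
    rw [sub_mul, mul_sub, mul_sub, twirl_sub, twirl_sub, twirl_sub, e1, e2, e4, e3]
    abel
  rw [norm_sub_rev, ← e]
  refine (h.norm_twirl_le _).trans ((norm_mul_le _ _).trans ?_)
  nlinarith [norm_nonneg (a - twirl x z a), norm_nonneg (b - twirl x z b)]

theorem norm_twirl_mul_self_sub_one_le (h : IsPauliPair x z) {a : A} {ε : ℝ} (ha : a * a = 1)
    (hε : ‖a - twirl x z a‖ ≤ ε) : ‖twirl x z a * twirl x z a - 1‖ ≤ ε ^ 2 := by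
  simpa [ha, h.twirl_one] using h.norm_twirl_mul_sub_le hε hε

theorem norm_twirl_anticommutator_le (h : IsPauliPair x z) {a b : A} {ε : ℝ} (hab : a * b + b * a = 0)
    (ha : ‖a - twirl x z a‖ ≤ ε) (hb : ‖b - twirl x z b‖ ≤ ε) :
    ‖twirl x z a * twirl x z b + twirl x z b * twirl x z a‖ ≤ 2 * ε ^ 2 := by
  have h1 := h.norm_twirl_mul_sub_le ha hb
  have h2 := h.norm_twirl_mul_sub_le hb ha
  have h0 : twirl x z (a * b) + twirl x z (b * a) = 0 := by
    rw [← twirl_add, hab]; simp [twirl, pinch]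
  have e : twirl x z a * twirl x z b + twirl x z b * twirl x z a =
      (twirl x z a * twirl x z b - twirl x z (a * b)) +
        (twirl x z b * twirl x z a - twirl x z (b * a)) := by
    rw [sub_add_sub_comm, h0, sub_zero]
  rw [e]
  linarith [norm_add_le (twirl x z a * twirl x z b - twirl x z (a * b))
        (twirl x z b * twirl x z a - twirl x z (b * a))]

theorem norm_twirl_commutator_le (h : IsPauliPair x z) {a b : A} {ε : ℝ} (hab : ‖a * b - b * a‖ ≤ ε)
    (ha : ‖a - twirl x z a‖ ≤ ε) (hb : ‖b - twirl x z b‖ ≤ ε) :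
    ‖twirl x z a * twirl x z b - twirl x z b * twirl x z a‖ ≤ ε + 2 * ε ^ 2 := by
  have h1 := h.norm_twirl_mul_sub_le ha hb
  have h2 := h.norm_twirl_mul_sub_le hb ha
  have h0 := h.norm_twirl_le (a * b - b * a)
  have e : twirl x z a * twirl x z b - twirl x z b * twirl x z a =
      twirl x z (a * b - b * a) + ((twirl x z a * twirl x z b - twirl x z (a * b)) -
        (twirl x z b * twirl x z a - twirl x z (b * a))) := by
    rw [twirl_sub]; abel
  rw [e]
  linarith [norm_add_le (twirl x z (a * b - b * a))
    ((twirl x z a * twirl x z b - twirl x z (a * b)) -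
        (twirl x z b * twirl x z a - twirl x z (b * a))),
    norm_sub_le (twirl x z a * twirl x z b - twirl x z (a * b))
        (twirl x z b * twirl x z a - twirl x z (b * a))]

end IsPauliPair

/-- Perturbing two contractions changes their commutator little. -/
theorem norm_commutator_le_of_near {a b s t : A} {δ η : ℝ} (ha : ‖a‖ ≤ 1) (ht : ‖t‖ ≤ 1)
    (hs : ‖s - a‖ ≤ δ) (htb : ‖t - b‖ ≤ δ) (h : ‖a * b - b * a‖ ≤ η) :
    ‖s * t - t * s‖ ≤ η + 4 * δ := by
  have e : s * t - t * s = (a * b - b * a) + (((s - a) * t - t * (s - a)) +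
      (a * (t - b) - (t - b) * a)) := by noncomm_ring
  rw [e]
  linarith [norm_add_le (a * b - b * a) (((s - a) * t - t * (s - a)) +
      (a * (t - b) - (t - b) * a)), norm_add_le ((s - a) * t - t * (s - a))
      (a * (t - b) - (t - b) * a), norm_sub_le ((s - a) * t) (t * (s - a)),
      norm_sub_le (a * (t - b)) ((t - b) * a), norm_mul_le_of_le_one_right hs ht,
      norm_mul_le_of_le_one_left ht hs, norm_mul_le_of_le_one_right htb ha,
      norm_mul_le_of_le_one_left ha htb]

end CStar

/-! ### Compression to a subspace. -/

section Compression

variable {H : Type*} [NormedAddCommGroup H] [InnerProductSpace ℂ H]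

/-- The compression of an operator to a subspace. -/
noncomputable def compression (K : Submodule ℂ H) [CompleteSpace K] (a : H →L[ℂ] H) : K →L[ℂ] K :=
  K.orthogonalProjectionOnto ∘L a ∘L K.subtypeL

variable (K : Submodule ℂ H) [CompleteSpace K]

theorem norm_compression_le (a : H →L[ℂ] H) : ‖compression K a‖ ≤ ‖a‖ := by
  have h1 := ContinuousLinearMap.opNorm_comp_le K.orthogonalProjectionOnto (a ∘L K.subtypeL)
  have h2 := ContinuousLinearMap.opNorm_comp_le a K.subtypeL
  have h3 := K.orthogonalProjectionOnto_norm_le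
  have h4 := K.norm_subtypeL_le
  rw [compression]
  nlinarith [norm_nonneg a, norm_nonneg (a ∘L K.subtypeL)]

theorem compression_isSelfAdjoint [CompleteSpace H] {a : H →L[ℂ] H} (ha : IsSelfAdjoint a) :
    IsSelfAdjoint (compression K a) := by
  rw [IsSelfAdjoint, ContinuousLinearMap.star_eq_adjoint, compression,
    ContinuousLinearMap.adjoint_comp, ContinuousLinearMap.adjoint_comp,
    Submodule.adjoint_subtypeL, Submodule.adjoint_orthogonalProjectionOnto,
    ← ContinuousLinearMap.star_eq_adjoint, ha.star_eq, ContinuousLinearMap.comp_assoc]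

theorem compression_one : compression K 1 = 1 := by
  ext v; simp [compression]

theorem compression_add (a b : H →L[ℂ] H) :
    compression K (a + b) = compression K a + compression K b := by
  ext v; simp [compression]

theorem compression_sub (a b : H →L[ℂ] H) :
    compression K (a - b) = compression K a - compression K b := by
  ext v; simp [compression]

theorem compression_mul (a : H →L[ℂ] H) {b : H →L[ℂ] H} (hb : ∀ v ∈ K, b v ∈ K) :
    compression K (a * b) = compression K a * compression K b := by
  ext v
  have : K.starProjection (b v) = b v := Submodule.starProjection_eq_self_iff.2 (hb v v.2)
  rw [Submodule.starProjection_apply] at this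
  simp [compression, this]

end Compression

/-! ### Passing to the `+1` eigenspace of one qubit. -/

section Reduction

variable {H : Type*} [NormedAddCommGroup H] [InnerProductSpace ℂ H] [CompleteSpace H]

theorem Qubit.isPauliPair (q : Qubit H) : IsPauliPair q.X q.Z :=
  ⟨q.isReflection_X.1, q.isReflection_X.2, q.isReflection_Z.1, q.isReflection_Z.2, q.anticommute⟩

/-- The space fixed by the second reflection of a qubit. -/
noncomputable def Qubit.plusSpace (q : Qubit H) : Submodule ℂ H :=
  LinearMap.ker ((q.Z - 1 : H →L[ℂ] H) : H →ₗ[ℂ] H)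

theorem Qubit.mem_plusSpace (q : Qubit H) {v : H} : v ∈ q.plusSpace ↔ q.Z v = v := by
  simp [Qubit.plusSpace, sub_eq_zero]

theorem Qubit.two_mul_finrank_plusSpace (q : Qubit H) [FiniteDimensional ℂ H] :
    2 * Module.finrank ℂ q.plusSpace = Module.finrank ℂ H := by
  have hXX : ∀ v, q.X (q.X v) = v := fun v => DFunLike.congr_fun q.isReflection_X.2 v
  have hZZ : ∀ v, q.Z (q.Z v) = v := fun v => DFunLike.congr_fun q.isReflection_Z.2 v
  have hXZ : ∀ v, q.X (q.Z v) = -q.Z (q.X v) := fun v =>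
    eq_neg_of_add_eq_zero_left (DFunLike.congr_fun q.anticommute v)
  let e : H ≃ₗ[ℂ] H := LinearEquiv.ofInvolutive (q.X : H →ₗ[ℂ] H) hXX
  -- The image under `q.X` is the `-1` eigenspace, a complement of equal dimension.
  set M : Submodule ℂ H := q.plusSpace.map (e : H →ₗ[ℂ] H) with hM
  have hmem : ∀ v, v ∈ M ↔ q.Z v = -v := fun v => by
    rw [hM, Submodule.mem_map]
    constructor
    · rintro ⟨w, hw, rfl⟩
      have h1 := hXZ w
      rw [q.mem_plusSpace.1 hw] at h1
      change q.Z (q.X w) = -q.X w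
      rw [← neg_eq_iff_eq_neg.2 h1]
    · intro hv
      refine ⟨q.X v, q.mem_plusSpace.2 ?_, hXX v⟩
      rw [← neg_eq_iff_eq_neg.2 (hXZ v), hv, map_neg, neg_neg]
  have hcompl : IsCompl q.plusSpace M := by
    constructor
    · rw [Submodule.disjoint_def]
      intro v h1 h2
      have h3 := q.mem_plusSpace.1 h1
      rw [(hmem v).1 h2] at h3
      have h4 : (2 : ℂ) • v = 0 := by rw [two_smul]; nth_rw 1 [← h3]; exact neg_add_cancel v
      exact (smul_eq_zero.1 h4).resolve_left two_ne_zero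
    · rw [codisjoint_iff, Submodule.eq_top_iff']
      intro v
      rw [Submodule.mem_sup]
      refine ⟨(1 / 2 : ℂ) • (v + q.Z v), q.mem_plusSpace.2 ?_, (1 / 2 : ℂ) • (v - q.Z v),
        (hmem _).2 ?_, by module⟩
      · rw [map_smul, map_add, hZZ, add_comm]
      · rw [map_smul, map_sub, hZZ]; module
  rw [← Submodule.finrank_add_eq_of_isCompl hcompl, two_mul, hM, LinearEquiv.finrank_map_eq]

theorem Qubit.norm_commutators_le_of_overlap_le {p q : Qubit H} {ε : ℝ} (h : p.overlap q ≤ ε) :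
    (‖p.X * q.X - q.X * p.X‖ ≤ ε ∧ ‖p.X * q.Z - q.Z * p.X‖ ≤ ε) ∧
      (‖p.Z * q.X - q.X * p.Z‖ ≤ ε ∧ ‖p.Z * q.Z - q.Z * p.Z‖ ≤ ε) := by
  simpa only [Qubit.overlap, max_le_iff] using h

theorem Qubit.twirl_mem_plusSpace (p : Qubit H) (a : H →L[ℂ] H) :
    ∀ v ∈ p.plusSpace, twirl p.X p.Z a v ∈ p.plusSpace := fun v hv => by
  have := DFunLike.congr_fun (p.isPauliPair.commute_right_twirl a).eq v
  rw [mem_plusSpace] at hv ⊢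
  simpa [hv] using this

/-- Compressing to the plus space of a qubit `p` turns a qubit that overlaps little with `p` into
one close to a twirl. -/
theorem Qubit.exists_near_compression (p q : Qubit H) [CompleteSpace p.plusSpace] {ε : ℝ}
    (hε : 5 * ε ^ 2 < 1) (h : p.overlap q ≤ ε) :
    ∃ q' : Qubit p.plusSpace,
      ‖q'.X - compression p.plusSpace (twirl p.X p.Z q.X)‖ ≤ 7 * ε ^ 2 ∧
      ‖q'.Z - compression p.plusSpace (twirl p.X p.Z q.Z)‖ ≤ 7 * ε ^ 2 := by
  obtain ⟨⟨hXX, hXZ⟩, hZX, hZZ⟩ := norm_commutators_le_of_overlap_le h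
  have hp := p.isPauliPair
  have hq := q.isPauliPair
  have hx := hp.norm_sub_twirl_le hXX hZX
  have hz := hp.norm_sub_twirl_le hXZ hZZ
  obtain ⟨x, z, hxs, hxx, hzs, hzz, hxz, hxa, hzb⟩ := exists_anticommuting_involutions_near
    (a := compression p.plusSpace (twirl p.X p.Z q.X))
    (b := compression p.plusSpace (twirl p.X p.Z q.Z))
    (compression_isSelfAdjoint p.plusSpace (hp.twirl_isSelfAdjoint hq.1))
    (compression_isSelfAdjoint p.plusSpace (hp.twirl_isSelfAdjoint hq.3))
    ((norm_compression_le _ _).trans ((hp.norm_twirl_le _).trans hq.norm_right)) hε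
    (by
      rw [← compression_mul _ _ (p.twirl_mem_plusSpace _), ← compression_one, ← compression_sub]
      exact (norm_compression_le _ _).trans (hp.norm_twirl_mul_self_sub_one_le hq.2 hx))
    (by
      rw [← compression_mul _ _ (p.twirl_mem_plusSpace _), ← compression_one, ← compression_sub]
      exact (norm_compression_le _ _).trans (hp.norm_twirl_mul_self_sub_one_le hq.4 hz))
    (by
      rw [← compression_mul _ _ (p.twirl_mem_plusSpace _), ← compression_mul _ _ (p.twirl_mem_plusSpace _), ← compression_add]
      exact (norm_compression_le _ _).trans (hp.norm_twirl_anticommutator_le hq.5 hx hz))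
  exact ⟨⟨x, z, ⟨hxs, hxx⟩, ⟨hzs, hzz⟩, hxz⟩, hxa, hzb⟩

/-- Given a qubit `p` and qubits that overlap little with `p` and each other, there are equally
many qubits on the plus space of `p` whose overlaps grow only to second order. -/
theorem Qubit.exists_qubits_plusSpace (p : Qubit H) [CompleteSpace p.plusSpace] {ι : Type*}
    (q : ι → Qubit H) {ε : ℝ} (hε : 5 * ε ^ 2 < 1) (hp : ∀ i, p.overlap (q i) ≤ ε)
    (hq : ∀ i j, i ≠ j → (q i).overlap (q j) ≤ ε) :
    ∃ q' : ι → Qubit p.plusSpace, ∀ i j, i ≠ j → (q' i).overlap (q' j) ≤ ε + 30 * ε ^ 2 := by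
  choose q' hX hZ using fun i => p.exists_near_compression (q i) hε (hp i)
  refine ⟨q', fun i j hij => ?_⟩
  have hP := p.isPauliPair
  -- Here `30 = 2 + 4 * 7`: 2 from twirling the commutator, 7 for each of the four error terms of
  -- the repair.
  have key : ∀ {a b : H →L[ℂ] H} {s t : p.plusSpace →L[ℂ] p.plusSpace}, ‖a‖ ≤ 1 → ‖t‖ ≤ 1 →
      ‖s - compression p.plusSpace (twirl p.X p.Z a)‖ ≤ 7 * ε ^ 2 →
      ‖t - compression p.plusSpace (twirl p.X p.Z b)‖ ≤ 7 * ε ^ 2 →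
      ‖a * b - b * a‖ ≤ ε → ‖a - twirl p.X p.Z a‖ ≤ ε → ‖b - twirl p.X p.Z b‖ ≤ ε →
      ‖s * t - t * s‖ ≤ ε + 30 * ε ^ 2 := by
    intro a b s t ha ht hs htb hab hta hb
    have := norm_commutator_le_of_near (η := ε + 2 * ε ^ 2)
      (a := compression p.plusSpace (twirl p.X p.Z a))
      (b := compression p.plusSpace (twirl p.X p.Z b))
      ((norm_compression_le p.plusSpace _).trans ((hP.norm_twirl_le _).trans ha)) ht hs htb (by
        rw [← compression_mul _ _ (p.twirl_mem_plusSpace _), ← compression_mul _ _ (p.twirl_mem_plusSpace _), ← compression_sub]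
        exact (norm_compression_le _ _).trans (hP.norm_twirl_commutator_le hab hta hb))
    linarith
  have hn : ∀ i, ‖(q i).X - twirl p.X p.Z (q i).X‖ ≤ ε ∧ ‖(q i).Z - twirl p.X p.Z (q i).Z‖ ≤ ε :=
    fun i => by
      obtain ⟨⟨hXX, hXZ⟩, hZX, hZZ⟩ := norm_commutators_le_of_overlap_le (hp i)
      exact ⟨hP.norm_sub_twirl_le hXX hZX, hP.norm_sub_twirl_le hXZ hZZ⟩
  obtain ⟨⟨hXX, hXZ⟩, hZX, hZZ⟩ := norm_commutators_le_of_overlap_le (hq i j hij)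
  have hqi := (q i).isPauliPair
  have hqj := (q' j).isPauliPair
  rw [Qubit.overlap]
  exact max_le
    (max_le (key hqi.norm_left hqj.norm_left (hX i) (hX j) hXX (hn i).1 (hn j).1)
      (key hqi.norm_left hqj.norm_right (hX i) (hZ j) hXZ (hn i).1 (hn j).2))
    (max_le (key hqi.norm_right hqj.norm_left (hZ i) (hX j) hZX (hn i).2 (hn j).1)
      (key hqi.norm_right hqj.norm_right (hZ i) (hZ j) hZZ (hn i).2 (hn j).2))

end Reduction

/-! ### The induction and the final bound. -/

theorem card_qubits_le_of_overlap_le (n : ℕ) : ∀ {H : Type*} [NormedAddCommGroup H]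
    [InnerProductSpace ℂ H] [CompleteSpace H], Module.finrank ℂ H = 2 ^ n →
    ∀ {ε : ℝ}, 0 ≤ ε → 64 * n * ε ≤ 1 → ∀ (m : ℕ) (q : Fin m → Qubit H),
    (∀ i j : Fin m, i ≠ j → (q i).overlap (q j) ≤ ε) → m ≤ n := by
  induction n with
  | zero =>
    intro H _ _ _ hdim ε _ _ m q _
    rcases m with _ | m
    · exact le_rfl
    have : FiniteDimensional ℂ H := Module.finite_of_finrank_pos (by rw [hdim]; positivity)
    -- A qubit forces even dimension, but the dimension is 1.
    have := (q 0).two_mul_finrank_plusSpace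
    rw [hdim] at this
    omega
  | succ n ih =>
    intro H _ _ _ hdim ε hε0 hε m q hq
    rcases m with _ | m
    · exact Nat.zero_le _
    have : FiniteDimensional ℂ H := Module.finite_of_finrank_pos (by rw [hdim]; positivity)
    have : CompleteSpace (q 0).plusSpace := FiniteDimensional.complete ℂ _
    have hfin := (q 0).two_mul_finrank_plusSpace
    rw [hdim, pow_succ] at hfin
    push_cast at hε
    have hn : (0 : ℝ) ≤ n := Nat.cast_nonneg n
    have hε1 : 64 * ε ≤ 1 := by nlinarith [mul_nonneg hn hε0]
    obtain ⟨q', hq'⟩ := (q 0).exists_qubits_plusSpace (fun i : Fin m => q i.succ) (ε := ε)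
      (by nlinarith) (fun i => hq _ _ (Fin.succ_ne_zero i).symm)
      (fun i j hij => hq _ _ fun h => hij (Fin.succ_injective _ h))
    refine Nat.succ_le_succ (ih (by omega) (by positivity) ?_ m q' hq')
    have h1 : 64 * n * ε ≤ 1 - 64 * ε := by linarith
    -- The lost summand `64 * ε` pays for the growth factor `1 + 30 * ε`.
    calc 64 * n * (ε + 30 * ε ^ 2) = 64 * n * ε * (1 + 30 * ε) := by ring
      _ ≤ (1 - 64 * ε) * (1 + 30 * ε) := by gcongr
      _ ≤ 1 := by nlinarith

theorem mainTheorem3 {H : Type*} [NormedAddCommGroup H] [InnerProductSpace ℂ H]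
    [CompleteSpace H] (n : ℕ) (hn : 1 ≤ n) (hdim : Module.finrank ℂ H = 2 ^ n)
    (ε : ℝ) (hε_lt : ε < 1) (hε : ε / (1 - ε) ^ 2 ≤ 1 / (64 * (n : ℝ)))
    (m : ℕ) (q : Fin m → Qubit H)
    (hq : ∀ i j : Fin m, i ≠ j → (q i).overlap (q j) ≤ ε) :
    m ≤ n := by
  -- For `ε ≥ 0`, `(1 - ε) ^ 2 ≤ 1` gives `ε ≤ 1 / (64 * n)`. For `ε < 0`, two qubits would give a
  -- negative norm, so `m ≤ 1`.
  rcases le_or_gt 0 ε with hε0 | hε0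
  · refine card_qubits_le_of_overlap_le n hdim hε0 ?_ m q hq
    have hn' : (0 : ℝ) < n := by exact_mod_cast hn
    have h1 : ε ≤ ε / (1 - ε) ^ 2 :=
      le_div_self hε0 (pow_pos (by linarith) 2) (pow_le_one₀ (by linarith) (by linarith))
    have h2 := h1.trans hε
    rw [le_div_iff₀ (by positivity)] at h2
    linarith
  · by_contra! hm
    have h := hq ⟨0, by omega⟩ ⟨1, by omega⟩ (by simp)
    have h' := (Qubit.norm_commutators_le_of_overlap_le h).1.1
    linarith [norm_nonneg ((q ⟨0, by omega⟩).X * (q ⟨1, by omega⟩).X -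
      (q ⟨1, by omega⟩).X * (q ⟨0, by omega⟩).X)]
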